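/- Let $X=\mathbb C^2/\Lambda$ be a complex abelian surface with intersection pairing $(\ ,\ )$ on $\operatorname{NS}(X)$ and ample class $h$. Let $\langle x,y\rangle=(x_1,y_1)-x_0y_2-x_2y_0$ be the Mukai pairing on $H^*(X,\mathbb Z)_{\mathrm{alg}}=\mathbb Z\oplus\operatorname{NS}(X)\oplus\mathbb Z\varrho_X$ and on its scalar extensions, and $e^{\gamma}=1+\gamma+\frac{(\gamma^2)}2\varrho_X$. Let $$\operatorname{Amp}(X)_{\mathbb R}=\{x\in \operatorname{NS}(X)_{\mathbb R}\mid (x^2)>0,\ (x,h)>0\},\qquad \overline{\operatorname{Amp}(X)}_{\mathbb R}=\{x\in \operatorname{NS}(X)_{\mathbb R}\mid (x^2)\ge 0,\ (x,h)>0\}.$$ For a subset $V$ of a finite dimensional real vector space write $C(V)=(V\setminus\{0\})/\mathbb R_{>0}$, with the quotient topology of the ambient space of rays. Put $\overline{\mathfrak H}=\operatorname{NS}(X)_{\mathbb R}\times C(\overline{\operatorname{Amp}(X)}_{\mathbb R})\times\mathbb R_{\ge 0}$, where a ray of $\overline{\operatorname{Amp}(X)}_{\mathbb R}$ is represented by its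 unit vector $H$ for a fixed norm on $\operatorname{NS}(X)_{\mathbb R}$. Let $v=(r,\xi,a)\in H^*(X,\mathbb Z)_{\mathrm{alg}}$ with $r\neq 0$ and $\langle v^2\rangle>0$. Put $\delta=\xi/r$, $a_\beta=-\langle e^\beta,v\rangle$, $Z_{(\beta,\omega)}(v)=\langle e^{\beta+\sqrt{-1}\omega},v\rangle$ and, for $(\beta,H,t)\in\overline{\mathfrak H}$, $$\xi(\beta,H,t)=r\Bigl(\tfrac{t^2(H^2)-((\beta-\delta)^2)}2+\tfrac{\langle v^2\rangle}{2r^2}\Bigr)\bigl(H+(\delta,H)\varrho_X\bigr)-r(\delta-\beta,H)\bigl(e^\beta-\tfrac{a_\beta}r\varrho_X\bigr).$$ Fix $H_0\in\operatorname{Amp}(X)_{\mathbb R}$ and let $v^\perp$ be the orthogonal complement of $v$ in $H^*(X,\mathbb Z)_{\mathrm{alg}}\otimes\mathbb R$ and $$\overline{P^+(v^\perp)}_{\mathbb R}=\{x\in v^\perp\mid \langle x^2\rangle\ge 0,\ \langle x,H_0+(H_0,\delta)\varrho_X\rangle>0\}.$$ Then $\xi(\beta,H,t)\ne0$ for every $(\beta,H,t)\in\overline{\mathfrak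 H}$, so that there is a map $$\Xi:\overline{\mathfrak H}\to C(H^*(X,\mathbb Z)_{\mathrm{alg}}\otimes\mathbb R),\qquad (\beta,H,t)\mapsto\mathbb R_{>0}\,\xi(\beta,H,t).$$ If $t>0$, then $Z_{(\beta,tH)}(v)\neq0$ and $\mathbb R_{>0}\,\xi(\beta,H,t)=\mathbb R_{>0}\operatorname{Im}\bigl(Z_{(\beta,tH)}(v)^{-1}e^{\beta+\sqrt{-1}tH}\bigr)$. If $r>0$, the image of $\Xi$ is exactly $C^+=C(\overline{P^+(v^\perp)}_{\mathbb R})$, and $\Xi(\beta,H,t)$ lies in the interior of $C^+$ relative to $C(v^\perp)$ whenever $tH\in \operatorname{Amp}(X)_{\mathbb R}$. If $r<0$, the same two assertions hold with $C^+$ replaced by $C(-\overline{P^+(v^\perp)}_{\mathbb R})$. -/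

import Mathlib

open scoped TensorProduct Pointwise

noncomputable section

/-- A complex torus of dimension two, `ℂ² / Λ`. -/
structure ComplexTwoTorus where
  /-- the period lattice -/
  lattice : Submodule ℤ (Fin 2 → ℂ)
  discrete : DiscreteTopology lattice
  isZLattice : IsZLattice ℝ lattice

/-- Alternating real bilinear forms on `ℂ²`. Seen as translation invariant `2`-forms, they are the
elements of `H²(X, ℝ)` for every complex torus `X = ℂ² / Λ`; those that are integral on `Λ` are the
elements of `H²(X, ℤ)`. -/
def TwoForm : Type := (Fin 2 → ℂ) [⋀^Fin 2]→L[ℝ] ℝ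

namespace TwoForm

instance : NormedAddCommGroup TwoForm :=
  inferInstanceAs (NormedAddCommGroup ((Fin 2 → ℂ) [⋀^Fin 2]→L[ℝ] ℝ))

instance : NormedSpace ℝ TwoForm :=
  inferInstanceAs (NormedSpace ℝ ((Fin 2 → ℂ) [⋀^Fin 2]→L[ℝ] ℝ))

instance : FunLike TwoForm (Fin 2 → Fin 2 → ℂ) ℝ :=
  inferInstanceAs (FunLike ((Fin 2 → ℂ) [⋀^Fin 2]→L[ℝ] ℝ) (Fin 2 → Fin 2 → ℂ) ℝ)

theorem zero_apply (x : Fin 2 → Fin 2 → ℂ) : (0 : TwoForm) x = 0 := rfl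

theorem add_apply (E F : TwoForm) (x : Fin 2 → Fin 2 → ℂ) : (E + F) x = E x + F x := rfl

theorem smul_apply (c : ℝ) (E : TwoForm) (x : Fin 2 → Fin 2 → ℂ) : (c • E) x = c * E x := rfl

theorem zsmul_apply (c : ℤ) (E : TwoForm) (x : Fin 2 → Fin 2 → ℂ) : (c • E) x = c * E x := by
  rw [← Int.cast_smul_eq_zsmul ℝ c E, smul_apply]

end TwoForm

namespace ComplexTwoTorus

/-- The wedge product of two alternating bilinear forms, evaluated at four vectors. -/
def wedge (E F : TwoForm) (x : Fin 4 → Fin 2 → ℂ) : ℝ :=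
  E ![x 0, x 1] * F ![x 2, x 3] - E ![x 0, x 2] * F ![x 1, x 3] + E ![x 0, x 3] * F ![x 1, x 2]
    + E ![x 1, x 2] * F ![x 0, x 3] - E ![x 1, x 3] * F ![x 0, x 2] + E ![x 2, x 3] * F ![x 0, x 1]

/-- The basis `e₁, √-1 e₁, e₂, √-1 e₂` of `ℂ²` over `ℝ`: it spans a parallelotope of volume one and
has the orientation of the complex structure. -/
def stdFrame : Fin 4 → Fin 2 → ℂ :=
  ![![1, 0], ![Complex.I, 0], ![0, 1], ![0, Complex.I]]

/-- The cup product `∫_X E ∧ F` on `H²(X, ℝ)`. The integral of the invariant `4`-form `E ∧ F` over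
`X = ℂ² / Λ` is its value on the unit frame times the volume of a fundamental domain of `Λ`. -/
def cupForm (X : ComplexTwoTorus) : LinearMap.BilinForm ℝ TwoForm :=
  LinearMap.mk₂ ℝ (fun E F => ZLattice.covolume X.lattice * wedge E F stdFrame)
    (fun _ _ _ => by simp only [wedge, TwoForm.add_apply]; ring)
    (fun _ _ _ => by simp only [wedge, TwoForm.smul_apply]; ring)
    (fun _ _ _ => by simp only [wedge, TwoForm.add_apply]; ring)
    (fun _ _ _ => by simp only [wedge, TwoForm.smul_apply]; ring)

/-- The Néron-Severi group `NS(X) = H²(X, ℤ) ∩ H^{1,1}(X)`: the alternating forms on `ℂ²` that are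
integral on the period lattice and invariant under multiplication by `√-1`. -/
def NS (X : ComplexTwoTorus) : Submodule ℤ TwoForm where
  carrier := {E | (∀ x y, E ![Complex.I • x, Complex.I • y] = E ![x, y]) ∧
    ∀ x ∈ X.lattice, ∀ y ∈ X.lattice, ∃ n : ℤ, E ![x, y] = n}
  zero_mem' := ⟨fun _ _ => rfl, fun _ _ _ _ => ⟨0, by simp [TwoForm.zero_apply]⟩⟩
  add_mem' := by
    rintro E F ⟨hE2, hE3⟩ ⟨hF2, hF3⟩
    refine ⟨fun x y => ?_, fun x hx y hy => ?_⟩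
    · simp only [TwoForm.add_apply, hE2, hF2]
    · obtain ⟨m, hm⟩ := hE3 x hx y hy
      obtain ⟨n, hn⟩ := hF3 x hx y hy
      exact ⟨m + n, by simp [TwoForm.add_apply, hm, hn]⟩
  smul_mem' := by
    rintro c E ⟨hE2, hE3⟩
    refine ⟨fun x y => ?_, fun x hx y hy => ?_⟩
    · simp only [TwoForm.zsmul_apply, hE2]
    · obtain ⟨m, hm⟩ := hE3 x hx y hy
      exact ⟨c * m, by simp [TwoForm.zsmul_apply, hm]⟩

/-- A class is ample when the corresponding invariant `(1,1)`-form is positive, that is, when the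
corresponding Hermitian form is positive definite. -/
def IsAmple (X : ComplexTwoTorus) (E : X.NS) : Prop :=
  ∀ x : Fin 2 → ℂ, x ≠ 0 → 0 < E.1 ![x, Complex.I • x]

/-- `NS(X)_ℝ`, realised as the real span of `NS(X)` in `H²(X, ℝ)`. It carries the usual topology
of a finite dimensional real vector space. -/
def NSR (X : ComplexTwoTorus) : Submodule ℝ TwoForm :=
  Submodule.span ℝ (X.NS : Set TwoForm)

/-- The map from `NS(X)` to `NS(X)_ℝ`. -/
def nsToReal (X : ComplexTwoTorus) (E : X.NS) : X.NSR :=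
  ⟨E.1, Submodule.subset_span E.2⟩

/-- The intersection form `( , )` on `NS(X)_ℝ`. -/
def inter (X : ComplexTwoTorus) : LinearMap.BilinForm ℝ X.NSR :=
  LinearMap.BilinForm.restrict X.cupForm X.NSR

end ComplexTwoTorus

/-- A complex abelian surface: a complex torus of dimension two with an ample class. -/
structure AbelianSurface extends ComplexTwoTorus where
  exists_ample : ∃ h : toComplexTwoTorus.NS, toComplexTwoTorus.IsAmple h

/-- The Mukai pairing `⟨x, y⟩ = (x₁, y₁) - x₀ y₂ - x₂ y₀` on `K ⊕ M ⊕ K`. -/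
def mukaiPairing {K M : Type*} [CommRing K] [AddCommGroup M] [Module K M]
    (B : LinearMap.BilinForm K M) (x y : K × M × K) : K :=
  B x.2.1 y.2.1 - x.1 * y.2.2 - x.2.2 * y.1

/-- The exponential `e^γ = 1 + γ + ((γ²)/2) ϱ`. -/
def mukaiExp {K M : Type*} [Field K] [AddCommGroup M] [Module K M]
    (B : LinearMap.BilinForm K M) (γ : M) : K × M × K :=
  (1, γ, B γ γ / 2)

/-- The space `C(M) = (M \ {0}) / ℝ_{>0}` of rays carries the quotient topology. -/
instance rayTopology {M : Type*} [AddCommMonoid M] [Module ℝ M] [TopologicalSpace M] :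
    TopologicalSpace (Module.Ray ℝ M) :=
  TopologicalSpace.coinduced (fun x : {x : M // x ≠ 0} => rayOfNeZero ℝ x.1 x.2) inferInstance

/-- `C(S) = (S \ {0}) / ℝ_{>0}`, as a subset of the space of all rays. -/
def raysOf {M : Type*} [AddCommMonoid M] [Module ℝ M] (S : Set M) : Set (Module.Ray ℝ M) :=
  {ρ | ∃ (x : M) (hx : x ≠ 0), x ∈ S ∧ ρ = rayOfNeZero ℝ x hx}

/-- The interior of `S` relative to `A`, for the subspace topology of `A`. -/
def relInterior {T : Type*} [TopologicalSpace T] (A S : Set T) : Set T :=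
  ((↑) : A → T) '' interior (((↑) : A → T) ⁻¹' S)

namespace AbelianSurface

/-- The algebraic Mukai lattice `ℤ ⊕ NS(X) ⊕ ℤ`. -/
abbrev Mukai (X : AbelianSurface) : Type := ℤ × X.NS × ℤ

/-- The algebraic Mukai lattice tensored with `ℝ`. -/
abbrev MukaiR (X : AbelianSurface) : Type := ℝ × X.NSR × ℝ

/-- `NS(X)_ℂ`. -/
abbrev NSC (X : AbelianSurface) : Type := ℂ ⊗[ℝ] X.NSR

/-- The algebraic Mukai lattice tensored with `ℂ`. -/
abbrev MukaiC (X : AbelianSurface) : Type := ℂ × X.NSC × ℂ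

variable (X : AbelianSurface)

/-- The Mukai vector `v` in the real algebraic Mukai lattice. -/
def toR (v : X.Mukai) : X.MukaiR := ((v.1 : ℝ), X.nsToReal v.2.1, (v.2.2 : ℝ))

/-- The map from the real to the complex algebraic Mukai lattice. -/
def toC (x : X.MukaiR) : X.MukaiC := ((x.1 : ℂ), (1 : ℂ) ⊗ₜ[ℝ] x.2.1, (x.2.2 : ℂ))

/-- The imaginary part of a vector of the complex algebraic Mukai lattice. -/
def imPart (z : X.MukaiC) : X.MukaiR :=
  (z.1.im, TensorProduct.lid ℝ X.NSR (LinearMap.rTensor X.NSR Complex.imLm z.2.1), z.2.2.im)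

/-- The intersection form on `NS(X)_ℂ`. -/
def interC : LinearMap.BilinForm ℂ X.NSC := LinearMap.BilinForm.baseChange ℂ X.inter

/-- The Mukai pairing on the real algebraic Mukai lattice. -/
def pair (x y : X.MukaiR) : ℝ := mukaiPairing X.inter x y

/-- `e^{β + √-1 ω}`. -/
def expC (β ω : X.NSR) : X.MukaiC :=
  mukaiExp X.interC ((1 : ℂ) ⊗ₜ[ℝ] β + Complex.I ⊗ₜ[ℝ] ω)

/-- The central charge `Z_{(β, ω)}(v) = ⟨e^{β + √-1 ω}, v⟩`. -/
def centralCharge (β ω : X.NSR) (v : X.Mukai) : ℂ :=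
  mukaiPairing X.interC (X.expC β ω) (X.toC (X.toR v))

/-- `Amp(X)_ℝ`; here `h` is an ample class. -/
def Amp (h : X.NS) : Set X.NSR :=
  {x | 0 < X.inter x x ∧ 0 < X.inter x (X.nsToReal h)}

/-- The set of all `x` in `NS(X)_ℝ` with `(x²) ≥ 0` and `(x, h) > 0`; here `h` is an ample
class. -/
def closedAmp (h : X.NS) : Set X.NSR :=
  {x | 0 ≤ X.inter x x ∧ 0 < X.inter x (X.nsToReal h)}

/-- The closed parameter space `NS(X)_ℝ × C(closedAmp) × ℝ_{≥ 0}`, where a ray in `closedAmp` is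
represented by its unit vector for the norm `N` on `NS(X)_ℝ`. -/
structure ClosedParam (h : X.NS) (N : Seminorm ℝ X.NSR) where
  β : X.NSR
  H : X.NSR
  t : ℝ
  H_mem : H ∈ X.closedAmp h
  H_unit : N H = 1
  t_nonneg : 0 ≤ t

/-- `δ = ξ / r`, for `v = (r, ξ, a)`. -/
def delta (v : X.Mukai) : X.NSR := (v.1 : ℝ)⁻¹ • X.nsToReal v.2.1

/-- `a_β = -⟨e^β, v⟩`. -/
def aCoeff (v : X.Mukai) (β : X.NSR) : ℝ := -X.pair (mukaiExp X.inter β) (X.toR v)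

/-- `D + (D, δ) ϱ`. -/
def twist (v : X.Mukai) (D : X.NSR) : X.MukaiR := (0, D, X.inter D (X.delta v))

/-- The vector `ξ(β, H, t)`, for `v = (r, ξ, a)` with `r ≠ 0`. -/
def xiVec (v : X.Mukai) (β H : X.NSR) (t : ℝ) : X.MukaiR :=
  ((v.1 : ℝ) * ((t ^ 2 * X.inter H H - X.inter (β - X.delta v) (β - X.delta v)) / 2
      + X.pair (X.toR v) (X.toR v) / (2 * (v.1 : ℝ) ^ 2))) • X.twist v H
    - ((v.1 : ℝ) * X.inter (X.delta v - β) H) •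
      (mukaiExp X.inter β - (0, 0, X.aCoeff v β / (v.1 : ℝ)))

/-- The orthogonal complement `v^⊥` in the real algebraic Mukai lattice. -/
def perp (v : X.Mukai) : Set X.MukaiR := {x | X.pair x (X.toR v) = 0}

/-- The closed positive cone of `v^⊥`; here `H₀` is an ample class. -/
def closedPosCone (v : X.Mukai) (H₀ : X.NSR) : Set X.MukaiR :=
  {x | x ∈ X.perp v ∧ 0 ≤ X.pair x x ∧ 0 < X.pair x (X.twist v H₀)}

end AbelianSurface

end

/-!
Write `s = ⟨v²⟩ / (2 r²)`, so that `v = r e^δ (1, 0, -s)` and `s > 0`. As `e^{-δ}` is an isometry of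
the Mukai pairing, `v^⊥` consists of the vectors `e^δ (c, D, s c)`, called `perpVec v c D` below, and
`⟨x²⟩ = (D²) - 2 s c²` on it. With `b = β - δ` and `A = (t² (H²) - (b²)) / 2 + s` one finds
(`xiVec_eq`)

  `ξ(β, H, t) = r e^δ ((b, H), A H + (b, H) b, s (b, H))`,

hence `⟨ξ²⟩ = r² (H²) (A² + t² (b, H)²)` and
`⟨ξ, H₀ + (H₀, δ) ϱ⟩ = r (A (H, H₀) + (b, H) (b, H₀))`. The central charge is
`Z(v) = r (A - √-1 t (b, H))`, and expanding `Im (Z⁻¹ e^{β + √-1 t H})` gives `ξ` times `t / |Z|²`.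

The image of `Ξ` lies in the cone because `A (H, H₀) + (b, H) (b, H₀)` is positive. This amounts to
`2 (b, H) (b, H₀) ≥ (b²) (H, H₀)` (`inter_self_mul_le`), a consequence of the Hodge index theorem,
which is elementary here: `(1,1)`-forms on `ℂ²` are Hermitian `2 × 2` matrices and the intersection
form is a multiple of the determinant. Positivity also shows that `A` and `(b, H)` do not both
vanish, so that `ξ` and, for `t > 0`, the central charge are nonzero, and that `⟨ξ²⟩ > 0` when
`t H` is in the positive cone; strict inequalities define an open set of rays.

Every ray of the cone is attained already with `t = 0`, `H` proportional to `D` and `b = l D`: the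
condition on `l` is a quadratic equation whose discriminant is `(D²) ⟨x²⟩ ≥ 0`
(`exists_xiVec_eq_smul`).
-/

/-! ### Evaluation of alternating forms -/

namespace TwoForm

theorem map_add_left (E : TwoForm) (x x' y : Fin 2 → ℂ) :
    E ![x + x', y] = E ![x, y] + E ![x', y] :=
  ContinuousAlternatingMap.vecCons_add (E : (Fin 2 → ℂ) [⋀^Fin 2]→L[ℝ] ℝ) ![y] x x'

theorem map_smul_left (E : TwoForm) (c : ℝ) (x y : Fin 2 → ℂ) :
    E ![c • x, y] = c * E ![x, y] :=
  ContinuousAlternatingMap.vecCons_smul (E : (Fin 2 → ℂ) [⋀^Fin 2]→L[ℝ] ℝ) ![y] c x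

theorem map_swap (E : TwoForm) (x y : Fin 2 → ℂ) : E ![y, x] = -E ![x, y] := by
  have := AlternatingMap.map_swap
    (ContinuousAlternatingMap.toAlternatingMap (E : (Fin 2 → ℂ) [⋀^Fin 2]→L[ℝ] ℝ))
    ![x, y] (i := 0) (j := 1) (by decide)
  rw [show (![x, y] ∘ Equiv.swap (0 : Fin 2) 1 : Fin 2 → Fin 2 → ℂ) = ![y, x] by
    ext i; fin_cases i <;> simp] at this
  exact this

theorem map_self (E : TwoForm) (x : Fin 2 → ℂ) : E ![x, x] = 0 := by
  linarith [E.map_swap x x]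

theorem map_add_right (E : TwoForm) (x y y' : Fin 2 → ℂ) :
    E ![x, y + y'] = E ![x, y] + E ![x, y'] := by
  rw [E.map_swap, E.map_add_left, E.map_swap x y, E.map_swap x y']; ring

theorem map_smul_right (E : TwoForm) (c : ℝ) (x y : Fin 2 → ℂ) :
    E ![x, c • y] = c * E ![x, y] := by
  rw [E.map_swap, E.map_smul_left, E.map_swap x y]; ring

theorem continuous_eval (x : Fin 2 → Fin 2 → ℂ) : Continuous fun E : TwoForm => E x :=
  (ContinuousAlternatingMap.apply ℝ (Fin 2 → ℂ) ℝ x).continuous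

end TwoForm

/-! ### The intersection form and the Hodge index theorem -/

namespace ComplexTwoTorus

variable (X : ComplexTwoTorus)

theorem NSR_invariant {E : TwoForm} (hE : E ∈ X.NSR) (x y : Fin 2 → ℂ) :
    E ![Complex.I • x, Complex.I • y] = E ![x, y] := by
  induction hE using Submodule.span_induction with
  | mem E hE => exact hE.1 x y
  | zero => rfl
  | add E F _ _ hE hF => simp only [TwoForm.add_apply, hE, hF]
  | smul c E _ hE => simp only [TwoForm.smul_apply, hE]

theorem covolume_pos : 0 < ZLattice.covolume X.lattice := by
  have := X.discrete
  have := X.isZLattice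
  exact ZLattice.covolume_pos X.lattice

theorem I_smul_stdFrame_zero : Complex.I • stdFrame 0 = stdFrame 1 := by
  ext i; fin_cases i <;> simp [stdFrame]

theorem I_smul_stdFrame_two : Complex.I • stdFrame 2 = stdFrame 3 := by
  ext i; fin_cases i <;> simp [stdFrame]

theorem I_smul_stdFrame_one : Complex.I • stdFrame 1 = (-1 : ℝ) • stdFrame 0 := by
  ext i; fin_cases i <;> simp [stdFrame]

theorem I_smul_stdFrame_three : Complex.I • stdFrame 3 = (-1 : ℝ) • stdFrame 2 := by
  ext i; fin_cases i <;> simp [stdFrame]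

theorem NSR_eval_one_three {E : TwoForm} (hE : E ∈ X.NSR) :
    E ![stdFrame 1, stdFrame 3] = E ![stdFrame 0, stdFrame 2] := by
  rw [← I_smul_stdFrame_zero, ← I_smul_stdFrame_two, X.NSR_invariant hE]

theorem NSR_eval_one_two {E : TwoForm} (hE : E ∈ X.NSR) :
    E ![stdFrame 1, stdFrame 2] = -E ![stdFrame 0, stdFrame 3] := by
  rw [← X.NSR_invariant hE, I_smul_stdFrame_one, I_smul_stdFrame_two, E.map_smul_left]; ring

/-- In the coordinates of a `(1,1)`-form on the standard frame, the intersection form is the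
polarisation of a multiple of the determinant of a Hermitian `2 × 2` matrix. -/
theorem inter_apply (E F : X.NSR) :
    X.inter E F = ZLattice.covolume X.lattice *
      (E.1 ![stdFrame 0, stdFrame 1] * F.1 ![stdFrame 2, stdFrame 3]
        + E.1 ![stdFrame 2, stdFrame 3] * F.1 ![stdFrame 0, stdFrame 1]
        - 2 * (E.1 ![stdFrame 0, stdFrame 2] * F.1 ![stdFrame 0, stdFrame 2])
        - 2 * (E.1 ![stdFrame 0, stdFrame 3] * F.1 ![stdFrame 0, stdFrame 3])) := by
  change ZLattice.covolume X.lattice * wedge E.1 F.1 stdFrame = _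
  rw [wedge, X.NSR_eval_one_three E.2, X.NSR_eval_one_three F.2, X.NSR_eval_one_two E.2,
    X.NSR_eval_one_two F.2]
  ring

theorem inter_comm (E F : X.NSR) : X.inter E F = X.inter F E := by
  rw [inter_apply, inter_apply]; ring

/-- The Hodge index theorem: the intersection form is negative semidefinite on the orthogonal
complement of a class of positive square. -/
theorem inter_self_nonpos {E F : X.NSR} (hF : 0 < X.inter F F) (hEF : X.inter E F = 0) :
    X.inter E E ≤ 0 := by
  have hc := X.covolume_pos
  rw [inter_apply] at hF hEF ⊢
  generalize E.1 ![stdFrame 0, stdFrame 1] = a at *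
  generalize E.1 ![stdFrame 2, stdFrame 3] = b at *
  generalize E.1 ![stdFrame 0, stdFrame 2] = c at *
  generalize E.1 ![stdFrame 0, stdFrame 3] = d at *
  generalize F.1 ![stdFrame 0, stdFrame 1] = a' at *
  generalize F.1 ![stdFrame 2, stdFrame 3] = b' at *
  generalize F.1 ![stdFrame 0, stdFrame 2] = c' at *
  generalize F.1 ![stdFrame 0, stdFrame 3] = d' at *
  have h1 := pos_of_mul_pos_right hF hc.le
  have h2 := (mul_eq_zero.mp hEF).resolve_left hc.ne'
  refine mul_nonpos_of_nonneg_of_nonpos hc.le ?_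
  by_contra! h3
  have h4 : (c ^ 2 + d ^ 2) * (c' ^ 2 + d' ^ 2) < (a * b) * (a' * b') :=
    mul_lt_mul'' (by linarith) (by linarith) (by positivity) (by positivity)
  have h5 : a * b' + b * a' = 2 * (c * c' + d * d') := by linarith
  have h6 : (a * b' + b * a') ^ 2 = 4 * (c * c' + d * d') ^ 2 := by rw [h5]; ring
  linarith [sq_nonneg (a * b' - b * a'), sq_nonneg (c * d' - d * c')]

theorem inter_self_pos_of_isAmple {h : X.NS} (hh : X.IsAmple h) :
    0 < X.inter (X.nsToReal h) (X.nsToReal h) := by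
  rw [inter_apply]
  have hm := (X.nsToReal h).2
  refine mul_pos X.covolume_pos ?_
  change ∀ x : Fin 2 → ℂ, x ≠ 0 → 0 < (X.nsToReal h).1 ![x, Complex.I • x] at hh
  generalize (X.nsToReal h).1 = E at *
  have hb : 0 < E ![stdFrame 2, stdFrame 3] := by
    rw [← I_smul_stdFrame_two]
    exact hh _ fun h0 => by simpa [stdFrame] using congrFun h0 1
  -- The value of the Hermitian form at `b e₁ - (d - √-1 c) e₂` is `b` times the determinant.
  have key := hh (E ![stdFrame 2, stdFrame 3] • stdFrame 0
    + ((-E ![stdFrame 0, stdFrame 3]) • stdFrame 2 + E ![stdFrame 0, stdFrame 2] • stdFrame 3))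
    fun h0 => hb.ne' (by simpa [stdFrame] using congrFun h0 0)
  rw [smul_add, smul_add, smul_comm, smul_comm Complex.I, smul_comm Complex.I,
    I_smul_stdFrame_zero, I_smul_stdFrame_two, I_smul_stdFrame_three] at key
  simp only [TwoForm.map_add_left, TwoForm.map_add_right, TwoForm.map_smul_left,
    TwoForm.map_smul_right, TwoForm.map_self, E.map_swap (stdFrame 2) (stdFrame 3),
    E.map_swap (stdFrame 1) (stdFrame 2), E.map_swap (stdFrame 1) (stdFrame 3),
    X.NSR_eval_one_three hm, X.NSR_eval_one_two hm] at key
  have := pos_of_mul_pos_right (b := E ![stdFrame 0, stdFrame 1] * E ![stdFrame 2, stdFrame 3]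
    - E ![stdFrame 0, stdFrame 2] ^ 2 - E ![stdFrame 0, stdFrame 3] ^ 2)
    (lt_of_lt_of_eq key (by ring)) hb.le
  linarith

/-- Two classes of nonnegative square on the positive side of a class of positive square have
positive intersection, as soon as one of them has positive square. -/
theorem inter_pos {h x y : X.NSR} (hh : 0 < X.inter h h) (hx : 0 ≤ X.inter x x)
    (hxh : 0 < X.inter x h) (hy : 0 < X.inter y y) (hyh : 0 < X.inter y h) :
    0 < X.inter x y := by
  by_contra! hxy
  have := X.inter_self_nonpos (E := X.inter x h • y - X.inter y h • x) hh
    (by simp only [map_sub, map_smul, LinearMap.sub_apply, LinearMap.smul_apply, smul_eq_mul]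
        ring)
  simp only [map_sub, map_smul, LinearMap.sub_apply, LinearMap.smul_apply, smul_eq_mul,
    X.inter_comm y x] at this
  have h1 : 0 < X.inter x h * (X.inter x h * X.inter y y) := by positivity
  have h2 : 0 ≤ X.inter y h * (X.inter y h * X.inter x x) := by positivity
  have h3 := mul_nonneg (mul_nonneg hxh.le hyh.le) (neg_nonneg.mpr hxy)
  linarith

/-- For Lorentzian forms, the quadratic form `b ↦ 2 (b, x) (b, y) - (b²) (x, y)` attached to two
vectors of the same half of the light cone is nonnegative: apply the Hodge index theorem to
`(x, y) b - (b, y) x`, which is orthogonal to `y`. -/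
theorem inter_self_mul_le {x y : X.NSR} (hx : 0 ≤ X.inter x x) (hy : 0 < X.inter y y)
    (hxy : 0 < X.inter x y) (b : X.NSR) :
    X.inter b b * X.inter x y ≤ 2 * (X.inter b x * X.inter b y) := by
  have := X.inter_self_nonpos (E := X.inter x y • b - X.inter b y • x) hy
    (by simp only [map_sub, map_smul, LinearMap.sub_apply, LinearMap.smul_apply, smul_eq_mul]
        ring)
  simp only [map_sub, map_smul, LinearMap.sub_apply, LinearMap.smul_apply, smul_eq_mul,
    X.inter_comm x b] at this
  have h1 : 0 ≤ X.inter b y * (X.inter b y * X.inter x x) := by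
    rw [← mul_assoc]; exact mul_nonneg (mul_self_nonneg _) hx
  exact le_of_mul_le_mul_left (by linarith) hxy

theorem continuous_inter : Continuous fun p : X.NSR × X.NSR => X.inter p.1 p.2 := by
  simp only [inter_apply]
  have h1 : ∀ x, Continuous fun p : X.NSR × X.NSR => p.1.1 x := fun x =>
    (TwoForm.continuous_eval x).comp (continuous_subtype_val.comp continuous_fst)
  have h2 : ∀ x, Continuous fun p : X.NSR × X.NSR => p.2.1 x := fun x =>
    (TwoForm.continuous_eval x).comp (continuous_subtype_val.comp continuous_snd)
  fun_prop

end ComplexTwoTorus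

/-! ### Open sets of rays -/

theorem isOpen_raysOf {M : Type*} [AddCommMonoid M] [Module ℝ M] [TopologicalSpace M]
    {S : Set M} (hS : IsOpen S) (hc : ∀ c : ℝ, 0 < c → ∀ x ∈ S, c • x ∈ S) :
    IsOpen (raysOf S) := by
  rw [isOpen_coinduced]
  convert hS.preimage continuous_subtype_val using 1
  ext ⟨x, hx⟩
  refine ⟨?_, fun h => ⟨x, hx, h, rfl⟩⟩
  rintro ⟨y, hy, hyS, hxy⟩
  obtain ⟨a, b, ha, hb, hab⟩ := ((ray_eq_iff hx hy).mp hxy).exists_pos hx hy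
  have := hc (a⁻¹ * b) (by positivity) y hyS
  rwa [mul_smul, ← hab, smul_smul, inv_mul_cancel₀ ha.ne', one_smul] at this

/-! ### The orthogonal complement of the Mukai vector -/

namespace AbelianSurface

variable (X : AbelianSurface)

/-- The number `⟨v²⟩ / (2 r²)`, for `v = (r, ξ, a)`. Then `v = r (e^δ - s ϱ)` with `s` this
number. -/
noncomputable def halfDisc (v : X.Mukai) : ℝ := X.pair (X.toR v) (X.toR v) / (2 * (v.1 : ℝ) ^ 2)

/-- The vector `e^δ (c, D, s c)` with `s = ⟨v²⟩ / (2 r²)`. These are the elements of `v^⊥`. -/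
noncomputable def perpVec (v : X.Mukai) (c : ℝ) (D : X.NSR) : X.MukaiR :=
  (c, D + c • X.delta v,
    X.halfDisc v * c + X.inter D (X.delta v) + c * X.inter (X.delta v) (X.delta v) / 2)

/-- The coefficient of `r (H + (δ, H) ϱ)` in `ξ(β, H, t)`. -/
noncomputable def xiCoeff (v : X.Mukai) (β H : X.NSR) (t : ℝ) : ℝ :=
  (t ^ 2 * X.inter H H - X.inter (β - X.delta v) (β - X.delta v)) / 2 + X.halfDisc v

variable {X} {v : X.Mukai}

theorem halfDisc_pos (hr : v.1 ≠ 0) (hv : 0 < X.pair (X.toR v) (X.toR v)) :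
    0 < X.halfDisc v := by
  have : (v.1 : ℝ) ≠ 0 := by exact_mod_cast hr
  unfold halfDisc
  positivity

theorem toR_eq (hr : v.1 ≠ 0) :
    X.toR v = ((v.1 : ℝ), (v.1 : ℝ) • X.delta v,
      (v.1 : ℝ) * (X.inter (X.delta v) (X.delta v) / 2 - X.halfDisc v)) := by
  have hr' : (v.1 : ℝ) ≠ 0 := by exact_mod_cast hr
  have h1 : X.nsToReal v.2.1 = (v.1 : ℝ) • X.delta v := by
    rw [delta, smul_smul, mul_inv_cancel₀ hr', one_smul]
  refine Prod.ext rfl (Prod.ext h1 ?_)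
  simp only [halfDisc, pair, mukaiPairing, toR, h1, map_smul, LinearMap.smul_apply, smul_eq_mul]
  field_simp
  ring

theorem smul_perpVec (k c : ℝ) (D : X.NSR) :
    k • X.perpVec v c D = X.perpVec v (k * c) (k • D) := by
  refine Prod.ext rfl (Prod.ext ?_ ?_)
  · simp only [perpVec, Prod.smul_mk, smul_add, smul_smul]
  · simp only [perpVec, Prod.smul_mk, map_smul, LinearMap.smul_apply, smul_eq_mul]
    ring

theorem twist_eq_perpVec (D : X.NSR) : X.twist v D = X.perpVec v 0 D := by
  simp [twist, perpVec]

theorem pair_perpVec (c c' : ℝ) (D D' : X.NSR) :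
    X.pair (X.perpVec v c D) (X.perpVec v c' D') =
      X.inter D D' - 2 * X.halfDisc v * (c * c') := by
  simp only [pair, mukaiPairing, perpVec, map_add, map_smul, LinearMap.add_apply,
    LinearMap.smul_apply, smul_eq_mul, X.inter_comm (X.delta v) D']
  ring

theorem pair_perpVec_toR (hr : v.1 ≠ 0) (c : ℝ) (D : X.NSR) :
    X.pair (X.perpVec v c D) (X.toR v) = 0 := by
  rw [toR_eq hr]
  simp only [pair, mukaiPairing, perpVec, map_add, map_smul, LinearMap.add_apply,
    LinearMap.smul_apply, smul_eq_mul]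
  ring

theorem exists_eq_perpVec (hr : v.1 ≠ 0) {x : X.MukaiR} (hx : x ∈ X.perp v) :
    ∃ c D, x = X.perpVec v c D := by
  have hr' : (v.1 : ℝ) ≠ 0 := by exact_mod_cast hr
  refine ⟨x.1, x.2.1 - x.1 • X.delta v, Prod.ext rfl (Prod.ext ?_ ?_)⟩
  · simp [perpVec]
  · replace hx : X.pair x (X.toR v) = 0 := hx
    rw [toR_eq hr] at hx
    simp only [pair, mukaiPairing, map_smul, smul_eq_mul] at hx
    simp only [perpVec, map_sub, map_smul, LinearMap.sub_apply, LinearMap.smul_apply, smul_eq_mul]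
    refine mul_left_cancel₀ hr' ?_
    linear_combination -hx

/-- Up to the factor `r`, applying `e^{-δ}` to `ξ(β, H, t)` gives
`A H + (b, H) (1, b, s)`, where `b = β - δ` and `A` is the coefficient `xiCoeff`. -/
theorem xiVec_eq (hr : v.1 ≠ 0) (β H : X.NSR) (t : ℝ) :
    X.xiVec v β H t = (v.1 : ℝ) • X.perpVec v (X.inter (β - X.delta v) H)
      (X.xiCoeff v β H t • H + X.inter (β - X.delta v) H • (β - X.delta v)) := by
  have hr' : (v.1 : ℝ) ≠ 0 := by exact_mod_cast hr
  have ha : X.aCoeff v β / v.1 =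
      X.inter (β - X.delta v) (β - X.delta v) / 2 - X.halfDisc v := by
    rw [aCoeff, toR_eq hr]
    simp only [pair, mukaiPairing, mukaiExp, map_sub, map_smul, LinearMap.sub_apply, smul_eq_mul,
      X.inter_comm (X.delta v) β]
    field_simp
    ring
  rw [xiVec, ha, ← halfDisc, ← xiCoeff]
  refine Prod.ext ?_ (Prod.ext ?_ ?_)
  · simp [twist, mukaiExp, perpVec]
    ring
  · simp only [twist, mukaiExp, perpVec, Prod.smul_mk, Prod.mk_sub_mk, sub_zero, map_sub,
      LinearMap.sub_apply]
    module
  · simp only [twist, mukaiExp, perpVec, Prod.smul_mk, Prod.mk_sub_mk, map_sub, map_add, map_smul,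
      LinearMap.sub_apply, LinearMap.add_apply, LinearMap.smul_apply, smul_eq_mul,
      X.inter_comm (X.delta v) β]
    ring

theorem pair_xiVec_self (hr : v.1 ≠ 0) (β H : X.NSR) (t : ℝ) :
    X.pair (X.xiVec v β H t) (X.xiVec v β H t) = (v.1 : ℝ) ^ 2 * (X.inter H H *
      (X.xiCoeff v β H t ^ 2 + (t * X.inter (β - X.delta v) H) ^ 2)) := by
  rw [xiVec_eq hr, smul_perpVec, pair_perpVec]
  simp only [map_add, map_smul, LinearMap.add_apply, LinearMap.smul_apply, smul_eq_mul,
    X.inter_comm H (β - X.delta v)]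
  have : X.inter (β - X.delta v) (β - X.delta v) =
      t ^ 2 * X.inter H H + 2 * X.halfDisc v - 2 * X.xiCoeff v β H t := by
    rw [xiCoeff]; ring
  rw [this]
  ring

theorem pair_xiVec_twist (hr : v.1 ≠ 0) (β H D : X.NSR) (t : ℝ) :
    X.pair (X.xiVec v β H t) (X.twist v D) = (v.1 : ℝ) *
      (X.xiCoeff v β H t * X.inter H D
        + X.inter (β - X.delta v) H * X.inter (β - X.delta v) D) := by
  rw [xiVec_eq hr, smul_perpVec, twist_eq_perpVec, pair_perpVec]
  simp only [map_add, map_smul, LinearMap.add_apply, LinearMap.smul_apply, smul_eq_mul]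
  ring

theorem xiVec_mem_perp (hr : v.1 ≠ 0) (β H : X.NSR) (t : ℝ) : X.xiVec v β H t ∈ X.perp v := by
  rw [xiVec_eq hr, smul_perpVec]
  exact pair_perpVec_toR hr _ _

theorem xiCoeff_mul_inter_add_pos (hs : 0 < X.halfDisc v) {H H₀ : X.NSR}
    (hH : 0 ≤ X.inter H H) (hH₀ : 0 < X.inter H₀ H₀) (hHH₀ : 0 < X.inter H H₀) (β : X.NSR)
    (t : ℝ) :
    0 < X.xiCoeff v β H t * X.inter H H₀
      + X.inter (β - X.delta v) H * X.inter (β - X.delta v) H₀ := by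
  have h1 := X.inter_self_mul_le hH hH₀ hHH₀ (β - X.delta v)
  have h2 : 0 ≤ t ^ 2 * X.inter H H * X.inter H H₀ := by positivity
  have h3 : 0 < X.halfDisc v * X.inter H H₀ := by positivity
  rw [xiCoeff]
  linarith

theorem inter_pos_of_mem_Amp {h : X.NS} (hh : X.IsAmple h) {H H₀ : X.NSR}
    (hH : H ∈ X.closedAmp h) (hH₀ : H₀ ∈ X.Amp h) : 0 < X.inter H H₀ :=
  X.inter_pos (X.inter_self_pos_of_isAmple hh) hH.1 hH.2 hH₀.1 hH₀.2

/-! ### Surjectivity onto the cone -/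

/-- A vector of `v^⊥` in the closed positive cone is attained up to a scalar of the sign of `r`,
already with `t = 0` and with `β - δ` proportional to `H`. -/
theorem exists_xiVec_eq_smul {h : X.NS} (hh : X.IsAmple h) {N : Seminorm ℝ X.NSR}
    (hN : ∀ x, N x = 0 → x = 0) (hr : v.1 ≠ 0) (hs : 0 < X.halfDisc v) {H₀ : X.NSR}
    (hH₀ : H₀ ∈ X.Amp h) {x : X.MukaiR} (hx : x ∈ X.closedPosCone v H₀) :
    ∃ p : X.ClosedParam h N, ∃ k : ℝ, 0 < k ∧
      X.xiVec v p.β p.H p.t = ((v.1 : ℝ) * k) • x := by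
  obtain ⟨hxp, hxx, hxt⟩ := hx
  obtain ⟨c, D, rfl⟩ := exists_eq_perpVec hr hxp
  rw [pair_perpVec] at hxx
  rw [twist_eq_perpVec, pair_perpVec, mul_zero, mul_zero, sub_zero] at hxt
  have hDD : 0 ≤ X.inter D D := by nlinarith [mul_self_nonneg c]
  have hDh : 0 < X.inter D (X.nsToReal h) := X.inter_pos hH₀.1 hDD hxt
    (X.inter_self_pos_of_isAmple hh) (by rw [X.inter_comm]; exact hH₀.2)
  have hn : 0 < N D := lt_of_le_of_ne (apply_nonneg N D) fun h0 => by
    rw [hN D h0.symm, map_zero, LinearMap.zero_apply] at hxt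
    exact hxt.false
  -- With `H = D / N D` and `β = δ + l D`, the ratio of the two coordinates of `ξ(β, H, 0)`
  -- is `c` exactly when `l` solves this quadratic equation; its discriminant is `(D²) ⟨x²⟩`.
  obtain ⟨l, hl⟩ : ∃ l : ℝ, l * X.inter D D =
      c * (X.halfDisc v + l ^ 2 * X.inter D D / 2) := by
    rcases eq_or_ne c 0 with rfl | hc
    · exact ⟨0, by ring⟩
    · have hD : 0 < X.inter D D := by
        have : 0 < X.halfDisc v * (c * c) := mul_pos hs (mul_self_pos.mpr hc)
        linarith
      have hsq := Real.sq_sqrt (mul_nonneg hD.le hxx)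
      set w := √(X.inter D D * (X.inter D D - 2 * X.halfDisc v * (c * c)))
      refine ⟨(X.inter D D - w) / (c * X.inter D D), ?_⟩
      field_simp
      linear_combination -hsq
  refine ⟨⟨X.delta v + l • D, (N D)⁻¹ • D, 0, ⟨?_, ?_⟩, ?_, le_rfl⟩,
    (N D)⁻¹ * (X.halfDisc v + l ^ 2 * X.inter D D / 2), by positivity, ?_⟩
  · simp only [map_smul, LinearMap.smul_apply, smul_eq_mul]
    positivity
  · simp only [map_smul, LinearMap.smul_apply, smul_eq_mul]
    positivity
  · rw [map_smul_eq_mul, Real.norm_of_nonneg (by positivity), inv_mul_cancel₀ hn.ne']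
  · rw [xiVec_eq hr, mul_smul, smul_perpVec ((N D)⁻¹ * _)]
    simp only [xiCoeff, add_sub_cancel_left, map_smul, LinearMap.smul_apply, smul_eq_mul]
    congr 2
    · linear_combination (N D)⁻¹ * hl
    · module

/-! ### The interior of the cone -/

theorem isOpen_setOf_pair_pos (ε : ℝ) (y : X.MukaiR) :
    IsOpen {x : X.MukaiR | 0 < X.pair x x ∧ 0 < ε * X.pair x y} := by
  have hp : Continuous fun p : X.MukaiR × X.MukaiR => X.pair p.1 p.2 := by
    have : Continuous fun p : X.MukaiR × X.MukaiR => X.inter p.1.2.1 p.2.2.1 :=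
      X.continuous_inter.comp (f := fun p : X.MukaiR × X.MukaiR => (p.1.2.1, p.2.2.1))
        (by fun_prop)
    unfold pair mukaiPairing
    fun_prop
  refine (isOpen_lt continuous_const (hp.comp (continuous_id.prodMk continuous_id))).inter
    (isOpen_lt continuous_const (continuous_const.mul
      (hp.comp (continuous_id.prodMk continuous_const))))

theorem pair_smul_left (k : ℝ) (x y : X.MukaiR) : X.pair (k • x) y = k * X.pair x y := by
  simp [pair, mukaiPairing]
  ring

theorem pair_smul_right (k : ℝ) (x y : X.MukaiR) : X.pair x (k • y) = k * X.pair x y := by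
  simp [pair, mukaiPairing]
  ring

/-- A vector of `v^⊥` satisfying strict inequalities spans a ray in the interior; the sign `ε`
accounts for the two halves of the cone. -/
theorem mem_relInterior {ε : ℝ} {y : X.MukaiR} {S : Set X.MukaiR}
    (hS : ∀ x ∈ X.perp v, 0 < X.pair x x → 0 < ε * X.pair x y → x ∈ S)
    {x : X.MukaiR} (hx : x ∈ X.perp v) (hx0 : x ≠ 0) (hxx : 0 < X.pair x x)
    (hxy : 0 < ε * X.pair x y) :
    rayOfNeZero ℝ x hx0 ∈ relInterior (raysOf (X.perp v)) (raysOf S) := by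
  refine ⟨⟨_, x, hx0, hx, rfl⟩, mem_interior.mpr
    ⟨_, ?_, (isOpen_raysOf (isOpen_setOf_pair_pos ε y) ?_).preimage continuous_subtype_val,
      ⟨x, hx0, ⟨hxx, hxy⟩, rfl⟩⟩, rfl⟩
  · rintro ⟨_, z, hz0, hz, rfl⟩ ⟨w, hw0, ⟨hww, hwy⟩, hzw⟩
    obtain ⟨a, b, ha, hb, hab⟩ := ((ray_eq_iff hz0 hw0).mp hzw).exists_pos hz0 hw0
    have hwz : w = (b⁻¹ * a) • z := by
      rw [mul_smul, hab, smul_smul, inv_mul_cancel₀ hb.ne', one_smul]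
    refine ⟨w, hw0, hS w ?_ hww hwy, hzw⟩
    change X.pair w _ = 0
    rw [hwz, pair_smul_left, show X.pair z _ = 0 from hz, mul_zero]
  · rintro c hc z ⟨h1, h2⟩
    refine ⟨?_, ?_⟩
    · rw [pair_smul_left, pair_smul_right]; positivity
    · rw [pair_smul_left, mul_left_comm]; positivity

/-! ### Comparison with the central charge -/

theorem centralCharge_eq (hr : v.1 ≠ 0) (β H : X.NSR) (t : ℝ) :
    X.centralCharge β (t • H) v =
      ⟨v.1 * X.xiCoeff v β H t, -(v.1 * (t * X.inter (β - X.delta v) H))⟩ := by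
  rw [centralCharge, toR_eq hr]
  apply Complex.ext <;>
  · simp only [mukaiPairing, expC, mukaiExp, toC, interC, map_add, LinearMap.add_apply,
      LinearMap.BilinForm.baseChange_tmul, xiCoeff, map_sub, map_smul, LinearMap.sub_apply,
      LinearMap.smul_apply, smul_eq_mul, X.inter_comm (X.delta v) β, X.inter_comm H β,
      X.inter_comm (X.delta v) H]
    simp
    ring

theorem imPart_smul_expC (k : ℂ) (β ω : X.NSR) :
    X.imPart (k • X.expC β ω) = (k.im, k.im • β + k.re • ω,
      k.im * (X.inter β β - X.inter ω ω) / 2 + k.re * X.inter β ω) := by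
  refine Prod.ext ?_ (Prod.ext ?_ ?_)
  · simp [imPart, expC, mukaiExp]
  · simp [imPart, expC, mukaiExp, TensorProduct.smul_tmul']
  · simp only [imPart, expC, mukaiExp, interC, map_add, LinearMap.add_apply,
      LinearMap.BilinForm.baseChange_tmul, X.inter_comm ω β]
    simp
    ring

theorem smul_imPart_eq_xiVec (hr : v.1 ≠ 0) (β H : X.NSR) {t : ℝ} (ht : 0 < t)
    (hZ : X.centralCharge β (t • H) v ≠ 0) :
    X.xiVec v β H t = (Complex.normSq (X.centralCharge β (t • H) v) / t) •
      X.imPart ((X.centralCharge β (t • H) v)⁻¹ • X.expC β (t • H)) := by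
  have hn : Complex.normSq (X.centralCharge β (t • H) v) ≠ 0 := by
    rwa [ne_eq, Complex.normSq_eq_zero]
  have hb : X.inter (β - X.delta v) (β - X.delta v) =
      t ^ 2 * X.inter H H + 2 * X.halfDisc v - 2 * X.xiCoeff v β H t := by
    rw [xiCoeff]; ring
  rw [imPart_smul_expC, Complex.inv_re, Complex.inv_im]
  generalize hn' : Complex.normSq (X.centralCharge β (t • H) v) = n at hn ⊢
  rw [centralCharge_eq hr, xiVec_eq hr]
  generalize X.xiCoeff v β H t = A at hb ⊢
  refine Prod.ext ?_ (Prod.ext ?_ ?_)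
  · simp [perpVec]
    field_simp
  · simp only [perpVec, Prod.smul_mk, smul_add, smul_smul, smul_sub]
    match_scalars <;> field_simp
    ring
  · simp only [perpVec, Prod.smul_mk, map_sub, map_add, map_smul, LinearMap.sub_apply,
      LinearMap.add_apply, LinearMap.smul_apply, smul_eq_mul, X.inter_comm (X.delta v) β,
      X.inter_comm H (X.delta v)] at hb ⊢
    field_simp
    linear_combination (X.inter (X.delta v) H - X.inter β H) * hb

end AbelianSurface

/-! ### The map to the cone of rays -/

open AbelianSurface in
theorem mainTheorem6 (X : AbelianSurface) (h : X.NS) (hh : X.IsAmple h)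
    (N : Seminorm ℝ X.NSR) (hN : ∀ x, N x = 0 → x = 0)
    (v : X.Mukai) (hr : v.1 ≠ 0) (hv : 0 < X.pair (X.toR v) (X.toR v))
    (H₀ : X.NSR) (hH₀ : H₀ ∈ X.Amp h) :
    ∃ Ξ : X.ClosedParam h N → Module.Ray ℝ X.MukaiR,
      (∀ p : X.ClosedParam h N, ∃ hp : X.xiVec v p.β p.H p.t ≠ 0,
        Ξ p = rayOfNeZero ℝ (X.xiVec v p.β p.H p.t) hp) ∧
      (∀ p : X.ClosedParam h N, 0 < p.t →
        X.centralCharge p.β (p.t • p.H) v ≠ 0 ∧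
        ∃ c : ℝ, 0 < c ∧ X.xiVec v p.β p.H p.t =
          c • X.imPart ((X.centralCharge p.β (p.t • p.H) v)⁻¹ • X.expC p.β (p.t • p.H))) ∧
      (0 < v.1 →
        Set.range Ξ = raysOf (X.closedPosCone v H₀) ∧
        ∀ p : X.ClosedParam h N, p.t • p.H ∈ X.Amp h →
          Ξ p ∈ relInterior (raysOf (X.perp v)) (raysOf (X.closedPosCone v H₀))) ∧
      (v.1 < 0 →
        Set.range Ξ = raysOf (-X.closedPosCone v H₀) ∧
        ∀ p : X.ClosedParam h N, p.t • p.H ∈ X.Amp h →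
          Ξ p ∈ relInterior (raysOf (X.perp v)) (raysOf (-X.closedPosCone v H₀))) := by
  have hs := halfDisc_pos hr hv
  have hr2 : (v.1 : ℝ) ≠ 0 := by exact_mod_cast hr
  have hpos : ∀ p : X.ClosedParam h N, 0 < X.xiCoeff v p.β p.H p.t * X.inter p.H H₀
      + X.inter (p.β - X.delta v) p.H * X.inter (p.β - X.delta v) H₀ := fun p =>
    xiCoeff_mul_inter_add_pos hs p.H_mem.1 hH₀.1 (inter_pos_of_mem_Amp hh p.H_mem hH₀) _ _
  have htw : ∀ p : X.ClosedParam h N,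
      0 < (v.1 : ℝ) * X.pair (X.xiVec v p.β p.H p.t) (X.twist v H₀) := fun p => by
    rw [pair_xiVec_twist hr, ← mul_assoc]
    exact mul_pos (mul_self_pos.mpr hr2) (hpos p)
  have hself : ∀ p : X.ClosedParam h N,
      0 ≤ X.pair (X.xiVec v p.β p.H p.t) (X.xiVec v p.β p.H p.t) := fun p => by
    rw [pair_xiVec_self hr]
    have := p.H_mem.1
    positivity
  have hcoeff : ∀ p : X.ClosedParam h N,
      X.xiCoeff v p.β p.H p.t ≠ 0 ∨ X.inter (p.β - X.delta v) p.H ≠ 0 := fun p => by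
    by_contra! h0
    have := hpos p
    rw [h0.1, h0.2] at this
    simp at this
  have hself_pos : ∀ p : X.ClosedParam h N, p.t • p.H ∈ X.Amp h →
      0 < X.pair (X.xiVec v p.β p.H p.t) (X.xiVec v p.β p.H p.t) := fun p hp => by
    have h1 := hp.1
    simp only [map_smul, LinearMap.smul_apply, smul_eq_mul] at h1
    have ht : p.t ≠ 0 := by
      intro h0
      simp [h0] at h1
    have hHH : 0 < X.inter p.H p.H := lt_of_le_of_ne p.H_mem.1 fun h0 => by simp [← h0] at h1
    rw [pair_xiVec_self hr]
    rcases hcoeff p with h2 | h2 <;> positivity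
  have hne : ∀ p : X.ClosedParam h N, X.xiVec v p.β p.H p.t ≠ 0 := fun p h0 => by
    have := htw p
    rw [h0] at this
    simp [pair, mukaiPairing] at this
  refine ⟨fun p => rayOfNeZero ℝ _ (hne p), fun p => ⟨hne p, rfl⟩, fun p ht => ?_, fun hr0 => ?_,
    fun hr0 => ?_⟩
  · have hZ : X.centralCharge p.β (p.t • p.H) v ≠ 0 := by
      rw [centralCharge_eq hr]
      intro h0
      rcases hcoeff p with h1 | h1
      · exact mul_ne_zero hr2 h1 (congrArg Complex.re h0)
      · exact neg_ne_zero.mpr (mul_ne_zero hr2 (mul_ne_zero ht.ne' h1)) (congrArg Complex.im h0)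
    exact ⟨hZ, _, div_pos (Complex.normSq_pos.mpr hZ) ht, smul_imPart_eq_xiVec hr _ _ ht hZ⟩
  · have hr1 : (0 : ℝ) < v.1 := by exact_mod_cast hr0
    refine ⟨Set.Subset.antisymm ?_ ?_, fun p hp => ?_⟩
    · rintro _ ⟨p, rfl⟩
      have hp : X.xiVec v p.β p.H p.t ∈ X.closedPosCone v H₀ :=
        ⟨xiVec_mem_perp hr _ _ _, hself p, pos_of_mul_pos_right (htw p) hr1.le⟩
      exact ⟨_, hne p, hp, rfl⟩
    · rintro _ ⟨x, hx0, hx, rfl⟩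
      obtain ⟨p, k, hk, hpk⟩ := exists_xiVec_eq_smul hh hN hr hs hH₀ hx
      refine ⟨p, (ray_eq_iff _ _).mpr ?_⟩
      rw [hpk]
      exact SameRay.sameRay_pos_smul_left _ (mul_pos hr1 hk)
    · exact mem_relInterior (ε := v.1) (y := X.twist v H₀) (S := X.closedPosCone v H₀)
        (fun x h1 h2 h3 => ⟨h1, h2.le, pos_of_mul_pos_right h3 hr1.le⟩)
        (xiVec_mem_perp hr _ _ _) _ (hself_pos p hp) (htw p)
  · have hr1 : (v.1 : ℝ) < 0 := by exact_mod_cast hr0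
    have hmem : ∀ x ∈ X.perp v, 0 ≤ X.pair x x → 0 < (v.1 : ℝ) * X.pair x (X.twist v H₀) →
        x ∈ -X.closedPosCone v H₀ := fun x h1 h2 h3 => by
      have hneg : -x = (-1 : ℝ) • x := by simp
      rw [Set.mem_neg, hneg]
      refine ⟨?_, ?_, ?_⟩
      · change X.pair _ _ = 0
        rw [pair_smul_left, show X.pair x _ = 0 from h1, mul_zero]
      · rw [pair_smul_left, pair_smul_right]; linarith
      · rw [pair_smul_left]
        linarith [neg_of_mul_pos_right h3 hr1.le]
    refine ⟨Set.Subset.antisymm ?_ ?_, fun p hp => ?_⟩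
    · rintro _ ⟨p, rfl⟩
      exact ⟨_, hne p, hmem _ (xiVec_mem_perp hr _ _ _) (hself p) (htw p), rfl⟩
    · rintro _ ⟨x, hx0, hx, rfl⟩
      obtain ⟨p, k, hk, hpk⟩ := exists_xiVec_eq_smul hh hN hr hs hH₀ hx
      refine ⟨p, (ray_eq_iff _ _).mpr ?_⟩
      rw [hpk, smul_neg, ← neg_smul]
      exact SameRay.sameRay_pos_smul_left _ (by nlinarith)
    · exact mem_relInterior (ε := v.1) (y := X.twist v H₀)
        (fun x h1 h2 h3 => hmem x h1 h2.le h3)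
        (xiVec_mem_perp hr _ _ _) _ (hself_pos p hp) (htw p)
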